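/- Let $p\colon E\to B$ and $p'\colon E'\to B'$ be (Hurewicz) fibrations, i.e. continuous maps having the homotopy lifting property with respect to all topological spaces, and let $h\colon E\to E'$ and $\bar h\colon B\to B'$ be continuous maps with $p'\circ h=\bar h\circ p$. If $h$ and $\bar h$ are homotopy equivalences, then $$\mathsf{TC}[p\colon E\to B]=\mathsf{TC}[p'\colon E'\to B'].$$ Here, with $I=[0,1]$, the parametrised topological complexity $\mathsf{TC}[p\colon E\to B]\in\{0,1,2,\dots\}\cup\{\infty\}$ is the sectional category of the parametrised endpoint map $$\Pi\colon E^I_B\to E\times_B E,\qquad \Pi(\gamma)=(\gamma(0),\gamma(1)),$$ where $E^I_B=\{\gamma\colon I\to E \text{ continuous}\mid p(\gamma(t))=p(\gamma(0))\text{ for all }t\in I\}$ carries the compact-open topology and $E\times_B E=\{(e_1,e_2)\in E\times E\mid p(e_1)=p(e_2)\}$ the subspace topology. The sectional category of a continuous map $q\colon X\to Y$ is the smallest integer $k\ge 0$ such that $Y$ has a cover by open sets $U_0,\dots,U_k$, each admitting a continuous map $\sigma_i\colon U_i\to X$ with $q\circ\sigma_i$ homotopic to the inclusion $U_i\hookrightarrow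 Y$; it is $\infty$ if there is no such $k$. -/

import Mathlib

namespace ParamTC

open scoped unitInterval

universe u v w

/-- The homotopy lifting property of `p` with respect to the space `X`. -/
def HasHLP {E : Type u} {B : Type v} [TopologicalSpace E] [TopologicalSpace B] (p : C(E, B))
    (X : Type w) [TopologicalSpace X] : Prop :=
  ∀ (f : C(X, E)) (H : C(X × I, B)), (∀ x, H (x, 0) = p (f x)) →
    ∃ K : C(X × I, E), (∀ x, K (x, 0) = f x) ∧ ∀ z, p (K z) = H z

/-- A (Hurewicz) fibration: the homotopy lifting property holds with respect to all spaces. The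
universe of the test spaces is no restriction, see `IsFibration.hasHLP`. -/
def IsFibration {E : Type u} {B : Type v} [TopologicalSpace E] [TopologicalSpace B]
    (p : C(E, B)) : Prop :=
  ∀ (X : Type (max u v)) [TopologicalSpace X], HasHLP p X

/-- A fibration has the homotopy lifting property with respect to spaces of every universe. -/
theorem IsFibration.hasHLP {E : Type u} {B : Type v} [TopologicalSpace E] [TopologicalSpace B]
    {p : C(E, B)} (hp : IsFibration p) (X : Type w) [TopologicalSpace X] : HasHLP p X := by
  intro f H hH
  obtain ⟨K, hK0, hK⟩ := hp {z : E × C(I, B) // z.2 0 = p z.1} ⟨fun z => z.1.1, by fun_prop⟩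
    ⟨fun z => z.1.1.2 z.2, by fun_prop⟩ (fun z => z.2)
  let g : C(X, {z : E × C(I, B) // z.2 0 = p z.1}) :=
    ⟨fun x => ⟨(f x, H.curry x), hH x⟩, by fun_prop⟩
  exact ⟨K.comp (g.prodMap (ContinuousMap.id I)), fun x => hK0 (g x), fun z => hK (g z.1, z.2)⟩

/-- The map `h` is a homotopy equivalence. -/
def IsHomotopyEquivalence {X : Type u} {Y : Type v} [TopologicalSpace X] [TopologicalSpace Y]
    (h : C(X, Y)) : Prop :=
  ∃ g : C(Y, X), (g.comp h).Homotopic (ContinuousMap.id X) ∧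
    (h.comp g).Homotopic (ContinuousMap.id Y)

/-- The inclusion of an open set, as a continuous map. -/
def openIncl {B : Type v} [TopologicalSpace B] (U : TopologicalSpace.Opens B) : C(U, B) :=
  ⟨Subtype.val, continuous_subtype_val⟩

/-- `p` admits a homotopy section over the open set `U`. -/
def HasLocalHomotopySection {E : Type u} {B : Type v} [TopologicalSpace E] [TopologicalSpace B]
    (p : C(E, B)) (U : TopologicalSpace.Opens B) : Prop :=
  ∃ s : C(U, E), (p.comp s).Homotopic (openIncl U)

/-- The sectional category of a map: the smallest `k` such that the base is covered by open sets
`U₀, …, Uₖ` each admitting a local homotopy section (and `⊤` if there is no such `k`). -/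
noncomputable def secat {E : Type u} {B : Type v} [TopologicalSpace E] [TopologicalSpace B]
    (p : C(E, B)) : ℕ∞ :=
  sInf {n : ℕ∞ | ∃ k : ℕ, n = k ∧ ∃ U : Fin (k + 1) → TopologicalSpace.Opens B,
    (∀ b, ∃ i, b ∈ U i) ∧ ∀ i, HasLocalHomotopySection p (U i)}

/-- The space of paths in `E` contained in a single fibre of `p`, topologised as a subspace of the
path space `C(I, E)` with the compact-open topology. -/
abbrev FibrePath {E : Type u} {B : Type v} [TopologicalSpace E] [TopologicalSpace B]
    (p : C(E, B)) : Type u :=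
  {γ : C(I, E) // ∀ t, p (γ t) = p (γ 0)}

/-- The fibred product `E ×_B E`, topologised as a subspace of `E × E`. -/
abbrev FibreProd {E : Type u} {B : Type v} [TopologicalSpace E] [TopologicalSpace B]
    (p : C(E, B)) : Type u :=
  {e : E × E // p e.1 = p e.2}

/-- The parametrised endpoint map `γ ↦ (γ 0, γ 1)`. -/
def endpointMap {E : Type u} {B : Type v} [TopologicalSpace E] [TopologicalSpace B]
    (p : C(E, B)) : C(FibrePath p, FibreProd p) :=
  ⟨fun γ => ⟨(γ.1 0, γ.1 1), (γ.2 1).symm⟩, by fun_prop⟩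

/-- The parametrised topological complexity of `p`. -/
noncomputable def paramTC {E : Type u} {B : Type v} [TopologicalSpace E] [TopologicalSpace B]
    (p : C(E, B)) : ℕ∞ :=
  secat (endpointMap p)

end ParamTC

/-! Sectional category cannot grow along a homotopy retraction of bases that lifts to total spaces,
so a bound on `paramTC` needs homotopies of fibred squares, hence homotopies through maps preserving
fibres. Lifting makes a homotopy inverse `g` of `h` cover one of `hbar`. Lifting the base homotopy
deforms `h ∘ g` to some `k` over the base, freely homotopic to the identity; a one-sided form of
Dold's theorem (`exists_right_inverse_over`) then gives `l` with `k ∘ l` fibrewise homotopic to the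
identity. Thus `g ∘ l` is a suitable right inverse of `h`, and symmetry gives equality. -/

namespace ParamTC

open ContinuousMap
open scoped unitInterval

section Lifting

universe u v w

variable {E : Type u} {B : Type v} {X : Type w} [TopologicalSpace E] [TopologicalSpace B]
  [TopologicalSpace X] {p : C(E, B)}

/-- A homotopy starting at `p ∘ f` lifts along the fibration `p` to a homotopy starting at `f`. -/
theorem IsFibration.exists_lift_homotopy (hp : IsFibration p) (f : C(X, E)) {a b : C(X, B)}
    (ha : p.comp f = a) (H : a.Homotopy b) :
    ∃ (f' : C(X, E)) (K : f.Homotopy f'), ∀ z, p (K z) = H z := by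
  subst ha
  obtain ⟨K, hK0, hK⟩ := hp.hasHLP X f (H.toContinuousMap.comp prodSwap) fun x => by simp
  refine ⟨⟨fun x => K (x, 1), by fun_prop⟩, ⟨K.comp prodSwap, fun x => ?_, fun x => rfl⟩, ?_⟩
  · exact hK0 x
  · rintro ⟨t, x⟩
    exact hK (x, t)

/-- A self-map over the base which is freely homotopic to the identity has a right homotopy
inverse over the base. -/
theorem IsFibration.exists_right_inverse_over (hp : IsFibration p) {f : C(E, E)}
    (hf : p.comp f = p) (H : f.Homotopy (.id E)) :
    ∃ g : C(E, E), p.comp g = p ∧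
      ∃ G : (f.comp g).Homotopy (.id E), ∀ t x, p (G (t, x)) = p x := by
  have hf' (x : E) : p (f x) = p x := DFunLike.congr_fun hf x
  let pH : p.Homotopy p := ((ContinuousMap.Homotopy.refl p).comp H).cast hf (by simp)
  obtain ⟨g, K, hK⟩ := hp.exists_lift_homotopy (.id E) (by simp) pH
  have hK' (t : I) (x : E) : p (K (t, x)) = p (H (t, x)) := hK (t, x)
  have hg (x : E) : p (g x) = p x := by simpa using hK' 1 x
  refine ⟨g, ContinuousMap.ext hg, ?_⟩
  -- The concatenation covers a loop of homotopies which traverses `p ∘ H` back and forth.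
  let J : (f.comp g).Homotopy (.id E) :=
    ((((ContinuousMap.Homotopy.refl f).comp K).symm).cast (by simp) (by simp)).trans H
  -- At height 0, `r` is the time of `p ∘ H` that `J` covers; raising the height pushes it to 1,
  -- where `p ∘ H` is `p`. This contracts the loop relative to its ends.
  let r : C(I × I, I) := ⟨fun z => Set.projIcc 0 1 zero_le_one (max |1 - 2 * (z.1 : ℝ)| z.2),
    continuous_projIcc.comp (by fun_prop)⟩
  have hr_one (s : I) : r (s, 1) = 1 := by
    refine Set.projIcc_of_right_le zero_le_one ?_
    simp
  have hr_left (t : I) : r (0, t) = 1 := by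
    refine Set.projIcc_of_right_le zero_le_one ?_
    simp
  have hr_right (t : I) : r (1, t) = 1 := by
    refine Set.projIcc_of_right_le zero_le_one ?_
    norm_num
  have hJ (s : I) (x : E) : p (J (s, x)) = p (H (r (s, 0), x)) := by
    have hs0 := s.2.1
    have hs1 := s.2.2
    simp only [J, Homotopy.trans_apply]
    split_ifs with hs
    · have : r (s, 0) = σ ⟨2 * s, by constructor <;> linarith⟩ := by
        apply Subtype.ext
        simp only [r, coe_mk, Set.coe_projIcc, unitInterval.coe_symm_eq, Set.Icc.coe_zero]
        rw [abs_of_nonneg (by linarith), max_eq_left (by linarith : (0 : ℝ) ≤ _),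
          min_eq_right (by linarith), max_eq_right (by linarith)]
      rw [this, ← hK']
      exact hf' _
    · have : r (s, 0) = ⟨2 * s - 1, by constructor <;> linarith⟩ := by
        apply Subtype.ext
        simp only [r, coe_mk, Set.coe_projIcc, Set.Icc.coe_zero]
        rw [abs_of_nonpos (by linarith), max_eq_left (by linarith : (0 : ℝ) ≤ _),
          min_eq_right (by linarith), max_eq_right (by linarith)]
        ring
      rw [this]
  obtain ⟨L, hL0, hL⟩ := hp.hasHLP (I × E) J.toContinuousMap
    ⟨fun z => p (H (r (z.1.1, z.2), z.1.2)), by fun_prop⟩ fun z => (hJ z.1 z.2).symm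
  -- Follow `L` along the three other sides of the square.
  let c (y : ℝ) : I := Set.projIcc 0 1 zero_le_one y
  have hc : Continuous c := continuous_projIcc
  have hc0 {y : ℝ} (hy : y ≤ 0) : c y = 0 := Set.projIcc_of_le_left zero_le_one hy
  have hc1 {y : ℝ} (hy : 1 ≤ y) : c y = 1 := Set.projIcc_of_right_le zero_le_one hy
  -- Clamping splits time into thirds: up the side `s = 0`, across the top, down the side `s = 1`.
  refine ⟨⟨⟨fun z => L ((c (3 * z.1 - 1), z.2), c (min (3 * z.1) (3 - 3 * z.1))), by fun_prop⟩,
    fun x => ?_, fun x => ?_⟩, fun t x => ?_⟩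
  · change L ((c (3 * ((0 : I) : ℝ) - 1), x),
      c (min (3 * ((0 : I) : ℝ)) (3 - 3 * ((0 : I) : ℝ)))) = _
    rw [hc0 (by simp), hc0 (by simp), hL0]
    exact J.map_zero_left x
  · change L ((c (3 * ((1 : I) : ℝ) - 1), x),
      c (min (3 * ((1 : I) : ℝ)) (3 - 3 * ((1 : I) : ℝ)))) = _
    rw [hc1 (by norm_num), hc0 (by simp), hL0]
    exact J.map_one_left x
  · refine (hL _).trans ?_
    change p (H (r (c (3 * (t : ℝ) - 1), c (min (3 * (t : ℝ)) (3 - 3 * (t : ℝ)))), x)) = p x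
    have key : r (c (3 * (t : ℝ) - 1), c (min (3 * (t : ℝ)) (3 - 3 * (t : ℝ)))) = 1 := by
      rcases le_total (3 * (t : ℝ)) 1 with h | h
      · rw [hc0 (by linarith), hr_left]
      rcases le_total 2 (3 * (t : ℝ)) with h' | h'
      · rw [hc1 (by linarith), hr_right]
      · rw [hc1 (le_min h (by linarith)), hr_one]
    rw [key, H.apply_one]
    rfl

end Lifting

section Domination

variable {X Y X' Y' : Type*} [TopologicalSpace X] [TopologicalSpace Y] [TopologicalSpace X']
  [TopologicalSpace Y'] {q : C(X, Y)} {q' : C(X', Y')}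

/-- The sectional category decreases along a homotopy retraction of the base that lifts to the
total spaces. -/
theorem secat_le_of_homotopy_retraction (φ : C(Y', Y)) (ψ : C(Y, Y')) (χ : C(X, X'))
    (hχ : q'.comp χ = ψ.comp q) (hψ : (ψ.comp φ).Homotopic (.id Y')) : secat q' ≤ secat q := by
  refine sInf_le_sInf ?_
  rintro _ ⟨k, rfl, U, hU, hs⟩
  refine ⟨k, rfl, fun i => (U i).comap φ, fun b => hU (φ b), fun i => ?_⟩
  obtain ⟨s, hs⟩ := hs i
  let φU : C((U i).comap φ, U i) := ⟨fun y => ⟨φ y.1, y.2⟩, by fun_prop⟩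
  refine ⟨(χ.comp s).comp φU, ?_⟩
  have h₁ : ((ψ.comp (q.comp s)).comp φU).Homotopic ((ψ.comp (openIncl (U i))).comp φU) :=
    (((Homotopic.refl ψ).comp hs)).comp (.refl φU)
  have h₂ : ((ψ.comp φ).comp (openIncl ((U i).comap φ))).Homotopic
      ((ContinuousMap.id Y').comp (openIncl ((U i).comap φ))) := hψ.comp (.refl _)
  have e : q'.comp ((χ.comp s).comp φU) = (ψ.comp (q.comp s)).comp φU := by
    rw [← ContinuousMap.comp_assoc, ← ContinuousMap.comp_assoc, hχ]
    rfl
  rw [e]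
  exact h₁.trans h₂

end Domination

section FibrePreserving

variable {E B E' B' : Type*} [TopologicalSpace E] [TopologicalSpace B] [TopologicalSpace E']
  [TopologicalSpace B'] {p : C(E, B)} {p' : C(E', B')}

/-- The map of fibred squares induced by a map sending fibres into fibres. -/
def FibreProd.map (f : C(E, E')) (hf : ∀ x y, p x = p y → p' (f x) = p' (f y)) :
    C(FibreProd p, FibreProd p') :=
  ⟨fun e => ⟨(f e.1.1, f e.1.2), hf _ _ e.2⟩, by fun_prop⟩

/-- The map of spaces of fibrewise paths induced by a map sending fibres into fibres. -/
def FibrePath.map (f : C(E, E')) (hf : ∀ x y, p x = p y → p' (f x) = p' (f y)) :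
    C(FibrePath p, FibrePath p') :=
  ⟨fun γ => ⟨f.comp γ.1, fun t => hf _ _ (γ.2 t)⟩, by fun_prop⟩

/-- A homotopy through maps sending fibres into fibres induces a homotopy on fibred squares. -/
theorem FibreProd.map_homotopic {f g : C(E, E')} (H : f.Homotopy g)
    (hH : ∀ t x y, p x = p y → p' (H (t, x)) = p' (H (t, y)))
    (hf : ∀ x y, p x = p y → p' (f x) = p' (f y)) (hg : ∀ x y, p x = p y → p' (g x) = p' (g y)) :
    (FibreProd.map f hf).Homotopic (FibreProd.map g hg) :=
  ⟨⟨⟨fun z => ⟨(H (z.1, z.2.1.1), H (z.1, z.2.1.2)), hH _ _ _ z.2.2⟩, by fun_prop⟩,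
    fun e => Subtype.ext (Prod.ext (H.apply_zero _) (H.apply_zero _)),
    fun e => Subtype.ext (Prod.ext (H.apply_one _) (H.apply_one _))⟩⟩

/-- A homotopy inverse of the total map of a pair of homotopy equivalences can be chosen to cover
a given homotopy inverse of the base map. -/
theorem IsFibration.exists_inverse_over (hp : IsFibration p) {h : C(E, E')} {hbar : C(B, B')}
    (hcomm : p'.comp h = hbar.comp p) (hh : IsHomotopyEquivalence h) {gbar : C(B', B)}
    (hgbar : (gbar.comp hbar).Homotopic (.id B)) :
    ∃ g : C(E', E), p.comp g = gbar.comp p' ∧ (g.comp h).Homotopic (.id E) ∧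
      (h.comp g).Homotopic (.id E') := by
  obtain ⟨g₀, hgh, hhg⟩ := hh
  -- The lifted homotopy covers `p g₀ ≃ gbar hbar p g₀ = gbar p' h g₀ ≃ gbar p'`.
  have h₁ : (((gbar.comp hbar).comp p).comp g₀).Homotopic (((ContinuousMap.id B).comp p).comp g₀) :=
    (hgbar.comp (.refl p)).comp (.refl g₀)
  have h₂ : ((gbar.comp p').comp (h.comp g₀)).Homotopic
      ((gbar.comp p').comp (ContinuousMap.id E')) := (Homotopic.refl _).comp hhg
  have e : ((gbar.comp hbar).comp p).comp g₀ = (gbar.comp p').comp (h.comp g₀) := by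
    rw [ContinuousMap.comp_assoc gbar, ← hcomm]
    rfl
  rw [e] at h₁
  obtain ⟨H⟩ := h₁.symm.trans h₂
  obtain ⟨g, K, hK⟩ := hp.exists_lift_homotopy g₀ rfl H
  have hg : g.Homotopic g₀ := ⟨K.symm⟩
  refine ⟨g, ContinuousMap.ext fun x => ?_, ?_, ?_⟩
  · simpa using (hK (1, x)).trans (H.apply_one x)
  · exact (hg.comp (.refl h)).trans hgh
  · exact ((Homotopic.refl h).comp hg).trans hhg

/-- The parametrised topological complexity does not increase along a map of fibrations which is a
homotopy equivalence with an inverse that is again a map of fibrations. -/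
theorem paramTC_le_of_inverse_over (hp' : IsFibration p') {h : C(E, E')} {hbar : C(B, B')}
    (hcomm : p'.comp h = hbar.comp p) {g : C(E', E)} {gbar : C(B', B)}
    (gcomm : p.comp g = gbar.comp p') (hhg : (h.comp g).Homotopic (.id E'))
    (hhgbar : (hbar.comp gbar).Homotopic (.id B')) : paramTC p' ≤ paramTC p := by
  obtain ⟨L⟩ := hhgbar
  have hcomm' (x : E) : p' (h x) = hbar (p x) := DFunLike.congr_fun hcomm x
  have gcomm' (x : E') : p (g x) = gbar (p' x) := DFunLike.congr_fun gcomm x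
  obtain ⟨k, M, hM⟩ := hp'.exists_lift_homotopy (h.comp g)
    (ContinuousMap.ext fun x => by simp [hcomm', gcomm']) (L.comp (ContinuousMap.Homotopy.refl p'))
  have hM' (t : I) (x : E') : p' (M (t, x)) = L (t, p' x) := hM (t, x)
  have hk : p'.comp k = p' := ContinuousMap.ext fun x => by simpa using hM' 1 x
  obtain ⟨N⟩ : k.Homotopic (.id E') := Homotopic.trans ⟨M.symm⟩ hhg
  obtain ⟨l, hl, G, hG⟩ := hp'.exists_right_inverse_over hk N
  have hl' (x : E') : p' (l x) = p' x := DFunLike.congr_fun hl x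
  have hk' (x : E') : p' (k x) = p' x := DFunLike.congr_fun hk x
  have fh (x y : E) (hxy : p x = p y) : p' (h x) = p' (h y) := by rw [hcomm', hcomm', hxy]
  have fg (x y : E') (hxy : p' x = p' y) : p (g (l x)) = p (g (l y)) := by
    rw [gcomm', gcomm', hl', hl', hxy]
  have fhg (x y : E') (hxy : p' x = p' y) : p' (h (g (l x))) = p' (h (g (l y))) :=
    fh _ _ (fg _ _ hxy)
  have fkl (x y : E') (hxy : p' x = p' y) : p' (k (l x)) = p' (k (l y)) := by
    rw [hk', hk', hl', hl', hxy]
  -- The factor `l` corrects `g`: the homotopy `M` preserves fibres, whereas `hhg` need not.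
  refine secat_le_of_homotopy_retraction (FibreProd.map (g.comp l) fg) (FibreProd.map h fh)
    (FibrePath.map h fh) rfl ?_
  have h₁ : (FibreProd.map ((h.comp g).comp l) fhg : C(FibreProd p', FibreProd p')).Homotopic
      (FibreProd.map (k.comp l) fkl) :=
    FibreProd.map_homotopic (M.comp (ContinuousMap.Homotopy.refl l))
      (fun t x y hxy => ((hM' t (l x)).trans (by rw [hl', hxy, ← hl' y])).trans (hM' t (l y)).symm)
      _ _
  have h₂ : (FibreProd.map (k.comp l) fkl : C(FibreProd p', FibreProd p')).Homotopic
      (FibreProd.map (.id E') fun _ _ hxy => hxy) :=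
    FibreProd.map_homotopic G (fun t x y hxy => by rw [hG, hG, hxy]) _ _
  exact h₁.trans h₂

end FibrePreserving

end ParamTC

theorem proposition2p5 {E B E' B' : Type*} [TopologicalSpace E] [TopologicalSpace B]
    [TopologicalSpace E'] [TopologicalSpace B']
    (p : C(E, B)) (p' : C(E', B')) (hp : ParamTC.IsFibration p) (hp' : ParamTC.IsFibration p')
    (h : C(E, E')) (hbar : C(B, B')) (hcomm : p'.comp h = hbar.comp p)
    (hh : ParamTC.IsHomotopyEquivalence h) (hhbar : ParamTC.IsHomotopyEquivalence hbar) :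
    ParamTC.paramTC p = ParamTC.paramTC p' := by
  obtain ⟨gbar, hgh, hhg⟩ := hhbar
  obtain ⟨g, gcomm, hgh', hhg'⟩ := hp.exists_inverse_over hcomm hh hgh
  exact le_antisymm (ParamTC.paramTC_le_of_inverse_over hp gcomm hcomm hgh' hgh)
    (ParamTC.paramTC_le_of_inverse_over hp' hcomm gcomm hhg' hhg)
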